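/- Let $S,K>0$ be a fixed spot price and a fixed strike, with zero interest rate, and set $x:=\ln(K/S)$. For each maturity $T>0$ let $C(T)$ be the price of the European call with strike $K$ and maturity $T$. Let $\sigma_{LN}=\sigma_{LN}(T)$ be its implied lognormal volatility, i.e. the unique $\sigma>0$ with $$S\,N(d_+)-K\,N(d_-)=C(T),\qquad d_\pm=\frac{\ln(S/K)\pm\frac12\sigma^2T}{\sigma\sqrt T},\qquad N(y)=\frac1{\sqrt{2\pi}}\int_{-\infty}^y e^{-u^2/2}\,du ,$$ which exists when $(S-K)_+<C(T)<S$. **Case 1 (short expiry).** Suppose $K\neq S$, and that the time-value $TV(T):=C(T)-(S-K)_+$ is positive for all small $T>0$ and tends to $0$ as $T\to0^+$. Put $$\lambda:=-\frac1{\ln(TV/S)},\qquad \gamma:=\ln\!\left(\frac{4\sqrt\pi\,e^{-x/2}}{|x|}\right),\qquad \alpha_1:=-\frac32-\frac{x^2}{16}.$$ Then, as $T\to0^+$, $\sigma_{LN}^2T=\frac{x^2}{2}\,v$ with $$v=\lambda-\tfrac32\lambda^2\ln\lambda+\gamma\lambda^2+\tfrac94\lambda^3\ln^2\lambda+\left(\tfrac94-3\gamma\right)\lambda^3\ln\lambda+\left(\gamma^2-\tfrac32\gamma-\alpha_1\right)\lambda^3+o(\lambda^3).$$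 **Case 2 (large expiry).** Suppose that the covered call $CC(T):=S-C(T)$ is positive for all large $T$ and tends to $0$ as $T\to+\infty$. Put $$\lambda:=-\frac1{\ln(CC/S)},\qquad \gamma:=\ln\!\left(\sqrt\pi\,e^{-x/2}\right),\qquad \alpha_1:=-\frac12-\frac{x^2}{16}.$$ Then, as $T\to+\infty$, $$\sigma_{LN}^2T=\frac8\lambda\left[1+\tfrac12\lambda\ln\lambda-\gamma\lambda-\tfrac14\lambda^2\ln\lambda+\left(\tfrac\gamma2+\alpha_1\right)\lambda^2+o(\lambda^2)\right].$$ In particular, as $T\to+\infty$, $$\sigma_{LN}\sim 2\sqrt{-\frac{2\ln(CC/S)}{T}} .$$ -/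

import Mathlib

open Filter Topology Asymptotics MeasureTheory

noncomputable section

/-- The standard normal distribution function `N`. -/
def normalN (y : ℝ) : ℝ :=
  (1 / Real.sqrt (2 * Real.pi)) * ∫ u in Set.Iic y, Real.exp (-u ^ 2 / 2)

/-- `d₊` of the Black–Scholes formula (zero interest rate). -/
def dPlus (S K T σ : ℝ) : ℝ :=
  (Real.log (S / K) + σ ^ 2 * T / 2) / (σ * Real.sqrt T)

/-- `d₋` of the Black–Scholes formula (zero interest rate). -/
def dMinus (S K T σ : ℝ) : ℝ :=
  (Real.log (S / K) - σ ^ 2 * T / 2) / (σ * Real.sqrt T)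

/-- The Black–Scholes price of a European call with spot `S`, strike `K`, maturity `T` and
lognormal volatility `σ` (zero interest rate). -/
def bsCall (S K T σ : ℝ) : ℝ :=
  S * normalN (dPlus S K T σ) - K * normalN (dMinus S K T σ)

/-- The implied lognormal volatility of a call priced at `c`: the positive `σ` with
`bsCall S K T σ = c`. For `S, K, T > 0` it exists exactly when `(S - K)₊ < c < S`, and it is
then unique, as the price is strictly increasing in `σ`. -/
def impliedVol (S K T c : ℝ) : ℝ :=
  Function.invFunOn (fun σ => bsCall S K T σ) (Set.Ioi 0) c

/-- The intrinsic value `(S - K)₊`. -/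
def intrinsicValue (S K : ℝ) : ℝ := max (S - K) 0

/-- The time-value of a call priced at `c`. -/
def timeValue (S K c : ℝ) : ℝ := c - intrinsicValue S K

/-- The covered call of a call priced at `c`. -/
def coveredCall (S c : ℝ) : ℝ := S - c

/-- The log-moneyness `x = ln (K / S)`. -/
def logMoneyness (S K : ℝ) : ℝ := Real.log (K / S)

end

/-!
The price depends on `σ` and `T` only through the total volatility `w = σ √T`, so everything is a
statement about the function `w ↦ bsCall S K 1 w` on `(0, ∞)`. Its derivative is explicit:
`S e^{x/2} (2π)^{-1/2} exp(-x²/(2w²) - w²/8)` (`hasDerivAt_bsCall_one`). Hence it increases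
strictly from the intrinsic value to the spot, so that the implied volatility exists, and the
hypotheses on `C` force `w → 0` in the short-expiry case and `w → ∞` in the large-expiry case.

The two regimes then become one. With `w² = x² v / 2` for the time-value and `w² = 8 / v` for the
covered call, the quantity `P(v)`, which is `e^γ TV / S` or `e^γ CC / S`, satisfies
`P'(v) = v^{p-2} exp(-1/v - x² v / 16)` and `P(0+) = 0`, with `p = 3/2` and `p = 1/2` respectively.
L'Hôpital's rule against `v^{p+1} e^{-1/v}` gives `P(v) = v^p e^{-1/v} (1 + α v + o(v))` with
`α = -p - x²/16` (`tendsto_laplace_remainder`). Taking logarithms, and as `log P = γ - 1/λ`,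
`1/λ = 1/v - p log v + γ - α v + o(v)`.

It remains to invert this relation. Put `u = λ/v - 1` and `L = log λ`. A first pass gives
`u = λ (p L - γ) + o(λ)`; feeding `log v = L - log (1 + u)` back into the relation gives
`u = λ (p L - γ) + λ² (-p² L + p γ + α) + o(λ²)` (`log_inversion`), which is the large-expiry
expansion. Expanding `v/λ = 1/(1 + u)` to second order (`log_inversion_inv`) gives the
short-expiry one.
-/

/-! ### Laplace-type asymptotics at `0+` -/

theorem tendsto_mul_log_pow_nhdsGT_zero (k : ℕ) :
    Tendsto (fun t : ℝ => t * Real.log t ^ k) (𝓝[>] 0) (𝓝 0) := by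
  rcases Nat.eq_zero_or_pos k with rfl | hk
  · simp only [pow_zero, mul_one]
    exact tendsto_id.mono_left nhdsWithin_le_nhds
  · have hk' : (0 : ℝ) < 1 / k := by positivity
    have h := (tendsto_log_mul_rpow_nhdsGT_zero hk').pow k
    rw [zero_pow hk.ne'] at h
    refine h.congr' ?_
    filter_upwards [self_mem_nhdsWithin] with t ht
    have ht : (0 : ℝ) < t := ht
    have : (t ^ (1 / (k : ℝ))) ^ k = t := by
      rw [← Real.rpow_natCast, ← Real.rpow_mul ht.le, one_div,
        inv_mul_cancel₀ (by exact_mod_cast hk.ne'), Real.rpow_one]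
    rw [mul_pow, this, mul_comm]

theorem hasDerivAt_rpow_mul_exp_neg_inv (p : ℝ) {v : ℝ} (hv : 0 < v) :
    HasDerivAt (fun v : ℝ => v ^ p * Real.exp (-1 / v))
      (v ^ (p - 2) * Real.exp (-1 / v) * (1 + p * v)) v := by
  have h1 : HasDerivAt (fun v : ℝ => v ^ p) (p * v ^ (p - 1)) v :=
    Real.hasDerivAt_rpow_const (Or.inl hv.ne')
  have h2 : HasDerivAt (fun v : ℝ => -1 / v) (1 / v ^ 2) v := by
    simpa [div_eq_mul_inv] using (hasDerivAt_inv hv.ne').fun_neg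
  refine (h1.mul h2.exp).congr_deriv ?_
  have e1 : v ^ p = v ^ (p - 2) * v ^ 2 := by
    rw [← Real.rpow_natCast v 2, ← Real.rpow_add hv]; norm_num
  have e2 : v ^ (p - 1) = v ^ (p - 2) * v := by
    nth_rewrite 3 [← Real.rpow_one v]
    rw [← Real.rpow_add hv]; ring_nf
  rw [e1, e2]
  field_simp
  ring

theorem tendsto_rpow_mul_exp_neg_inv {p : ℝ} (hp : 0 < p) :
    Tendsto (fun v : ℝ => v ^ p * Real.exp (-1 / v)) (𝓝[>] 0) (𝓝 0) := by
  have h1 : Tendsto (fun v : ℝ => v ^ p) (𝓝[>] 0) (𝓝 0) := by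
    have := (Real.continuousAt_rpow_const 0 p (Or.inr hp.le)).tendsto
    rw [Real.zero_rpow hp.ne'] at this
    exact this.mono_left nhdsWithin_le_nhds
  refine squeeze_zero' ?_ ?_ h1
  · filter_upwards [self_mem_nhdsWithin] with v hv
    have hv : (0 : ℝ) < v := hv
    positivity
  · filter_upwards [self_mem_nhdsWithin] with v hv
    have hv : (0 : ℝ) < v := hv
    refine mul_le_of_le_one_right (by positivity) (Real.exp_le_one_iff.2 ?_)
    rw [neg_div]; exact neg_nonpos.2 (by positivity)

/-- A Laplace-type expansion at `0+`: an antiderivative of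
`v ^ (p - 2) * exp (-1 / v - c * v)` vanishing at `0+` equals
`v ^ p * exp (-1 / v) * (1 - (p + c) * v + o(v))`. -/
theorem tendsto_laplace_remainder {P : ℝ → ℝ} {p c : ℝ} (hp : 0 < p)
    (hP : ∀ v, 0 < v → HasDerivAt P (v ^ (p - 2) * Real.exp (-1 / v - c * v)) v)
    (h0 : Tendsto P (𝓝[>] 0) (𝓝 0)) :
    Tendsto (fun v => (P v / (v ^ p * Real.exp (-1 / v)) - 1) / v) (𝓝[>] 0) (𝓝 (-p - c)) := by
  set α : ℝ := -p - c with hα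
  have hid : Tendsto (fun v : ℝ => v) (𝓝[>] 0) (𝓝 0) :=
    (tendsto_id (α := ℝ)).mono_left nhdsWithin_le_nhds
  have key : Tendsto (fun v => (P v - v ^ p * Real.exp (-1 / v) * (1 + α * v)) /
      (v ^ (p + 1) * Real.exp (-1 / v))) (𝓝[>] 0) (𝓝 0) := by
    have hpos : ∀ᶠ v : ℝ in 𝓝[>] 0, 0 < v := self_mem_nhdsWithin
    refine HasDerivAt.lhopital_zero_nhdsGT
      (f' := fun v => v ^ (p - 2) * Real.exp (-1 / v - c * v) -
        (v ^ (p - 2) * Real.exp (-1 / v) * (1 + p * v) * (1 + α * v) +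
          v ^ p * Real.exp (-1 / v) * α))
      (g' := fun v => v ^ (p + 1 - 2) * Real.exp (-1 / v) * (1 + (p + 1) * v)) ?_ ?_ ?_ ?_ ?_ ?_
    · filter_upwards [hpos] with v hv
      have h1 : HasDerivAt (fun v : ℝ => 1 + α * v) α v := by
        simpa using ((hasDerivAt_id v).const_mul α).const_add 1
      exact (hP v hv).sub ((hasDerivAt_rpow_mul_exp_neg_inv p hv).mul h1)
    · filter_upwards [hpos] with v hv using hasDerivAt_rpow_mul_exp_neg_inv (p + 1) hv
    · filter_upwards [hpos] with v hv
      positivity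
    · have h1 : Tendsto (fun v : ℝ => 1 + α * v) (𝓝[>] 0) (𝓝 (1 + α * 0)) :=
        (hid.const_mul α).const_add 1
      simpa using h0.sub ((tendsto_rpow_mul_exp_neg_inv hp).mul h1)
    · exact tendsto_rpow_mul_exp_neg_inv (by linarith)
    -- the quotient of derivatives reduces to `exp (-c v) - 1 + c v - α (p + 1) v ^ 2` over
    -- `v (1 + (p + 1) v)`; the choice of `α` is what cancels the linear term
    · have hd : HasDerivAt (fun v : ℝ => Real.exp (-(c * v)) + c * v) 0 0 := by
        have h1 : HasDerivAt (fun v : ℝ => c * v) c 0 := by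
          simpa using (hasDerivAt_id (0 : ℝ)).const_mul c
        simpa using h1.fun_neg.exp.fun_add h1
      have hs : Tendsto (fun v : ℝ => (Real.exp (-(c * v)) + c * v - 1) / v) (𝓝[>] 0) (𝓝 0) := by
        have := (hasDerivAt_iff_tendsto_slope.1 hd).mono_left
          (nhdsWithin_mono (0 : ℝ) (fun v (hv : 0 < v) => ne_of_gt hv : Set.Ioi (0 : ℝ) ⊆ {0}ᶜ))
        refine this.congr fun v => ?_
        simp [slope_def_field]
      have hlim : Tendsto (fun v : ℝ => ((Real.exp (-(c * v)) + c * v - 1) / v -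
          α * (p + 1) * v) / (1 + (p + 1) * v)) (𝓝[>] 0)
          (𝓝 ((0 - α * (p + 1) * 0) / (1 + (p + 1) * 0))) :=
        (hs.sub (hid.const_mul _)).div ((hid.const_mul _).const_add 1) (by simp)
      simp only [mul_zero, sub_zero, zero_div] at hlim
      refine hlim.congr' ?_
      filter_upwards [hpos] with v hv
      have e1 : v ^ p = v ^ (p - 2) * v ^ 2 := by
        rw [← Real.rpow_natCast v 2, ← Real.rpow_add hv]; norm_num
      have e2 : v ^ (p + 1 - 2) = v ^ (p - 2) * v := by
        nth_rewrite 3 [← Real.rpow_one v]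
        rw [← Real.rpow_add hv]; ring_nf
      have e3 : Real.exp (-1 / v - c * v) = Real.exp (-1 / v) * Real.exp (-(c * v)) := by
        rw [← Real.exp_add]; ring_nf
      rw [e1, e2, e3]
      have : 0 < v ^ (p - 2) := by positivity
      have : 0 < 1 + (p + 1) * v := by positivity
      have := Real.exp_pos (-1 / v)
      rw [div_eq_div_iff (by positivity) (by positivity)]
      field_simp
      rw [hα]; ring
  have := key.add_const α
  rw [zero_add] at this
  refine this.congr' ?_
  filter_upwards [self_mem_nhdsWithin] with v hv
  have hv : (0 : ℝ) < v := hv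
  have e1 : v ^ (p + 1) = v ^ p * v := by rw [Real.rpow_add hv, Real.rpow_one]
  rw [e1]
  have : 0 < v ^ p := by positivity
  field_simp
  ring

theorem tendsto_log_one_add_div {ι : Type*} {l : Filter ι} {h v : ι → ℝ} {a : ℝ}
    (hv : ∀ᶠ i in l, 0 < v i) (hh : Tendsto h l (𝓝 0))
    (ha : Tendsto (fun i => h i / v i) l (𝓝 a)) :
    Tendsto (fun i => Real.log (1 + h i) / v i) l (𝓝 a) := by
  have hpos : ∀ᶠ i in l, 0 < 1 + h i := by
    filter_upwards [hh.eventually (lt_mem_nhds (show (-1 : ℝ) < 0 by norm_num))] with i hi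
    linarith
  have hlow : Tendsto (fun i => h i / v i / (1 + h i)) l (𝓝 (a / (1 + 0))) :=
    ha.div (hh.const_add 1) (by norm_num)
  simp only [add_zero, div_one] at hlow
  refine tendsto_of_tendsto_of_tendsto_of_le_of_le' hlow ha ?_ ?_
  · filter_upwards [hv, hpos] with i hi hi'
    rw [div_right_comm]
    refine div_le_div_of_nonneg_right ?_ hi.le
    have h3 : h i / (1 + h i) = 1 - (1 + h i)⁻¹ := by field_simp; ring
    rw [h3]
    exact Real.one_sub_inv_le_log_of_pos hi'
  · filter_upwards [hv, hpos] with i hi hi'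
    refine div_le_div_of_nonneg_right ?_ hi.le
    linarith [Real.log_le_sub_one_of_pos hi']

/-- Logarithmic form of `tendsto_laplace_remainder`:
`log (P v) = p * log v - 1 / v - (p + c) * v + o(v)`. -/
theorem tendsto_log_laplace_remainder {P : ℝ → ℝ} {p c : ℝ} (hp : 0 < p)
    (hP : ∀ v, 0 < v → HasDerivAt P (v ^ (p - 2) * Real.exp (-1 / v - c * v)) v)
    (h0 : Tendsto P (𝓝[>] 0) (𝓝 0)) :
    Tendsto (fun v => (Real.log (P v) - p * Real.log v + 1 / v) / v) (𝓝[>] 0) (𝓝 (-p - c)) := by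
  have hid : Tendsto (fun v : ℝ => v) (𝓝[>] 0) (𝓝 0) :=
    (tendsto_id (α := ℝ)).mono_left nhdsWithin_le_nhds
  have hpos : ∀ᶠ v : ℝ in 𝓝[>] 0, 0 < v := self_mem_nhdsWithin
  have hr := tendsto_laplace_remainder hp hP h0
  have hh : Tendsto (fun v => P v / (v ^ p * Real.exp (-1 / v)) - 1) (𝓝[>] 0) (𝓝 0) := by
    have := hr.mul hid
    rw [mul_zero] at this
    refine this.congr' ?_
    filter_upwards [hpos] with v hv using div_mul_cancel₀ _ hv.ne'
  refine (tendsto_log_one_add_div hpos hh hr).congr' ?_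
  filter_upwards [hpos, hh.eventually (lt_mem_nhds (show (-1 : ℝ) < 0 by norm_num))] with v hv hv'
  have hD : 0 < v ^ p * Real.exp (-1 / v) := by positivity
  have hP0 : P v ≠ 0 := by
    intro h
    rw [h] at hv'
    norm_num at hv'
  congr 1
  rw [add_sub_cancel, Real.log_div hP0 hD.ne', Real.log_mul (by positivity) (by positivity),
    Real.log_exp, Real.log_rpow hv]
  ring

/-! ### Inversion of the logarithmic relation -/

/-- Inversion of `1 / lam = 1 / v - p * log v + γ - α * v + o(v)` as `v → 0+`. The relation forces
`lam` to be positive, to tend to `0` and to be equivalent to `v`; with `L = log lam`, its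
second-order form is
`lam / v = 1 + lam * (p * L - γ) + lam ^ 2 * (-p ^ 2 * L + p * γ + α) + o(lam ^ 2)`. -/
theorem log_inversion {ι : Type*} {l : Filter ι} {v lam : ι → ℝ} {p γ α : ℝ}
    (hv : ∀ᶠ i in l, 0 < v i) (hv0 : Tendsto v l (𝓝 0))
    (hE : Tendsto (fun i => (1 / v i - p * Real.log (v i) + γ - 1 / lam i) / v i) l (𝓝 α)) :
    (∀ᶠ i in l, 0 < lam i) ∧ Tendsto lam l (𝓝 0) ∧
    Tendsto (fun i => lam i / v i) l (𝓝 1) ∧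
    Tendsto (fun i => (lam i / v i - 1 - lam i * (p * Real.log (lam i) - γ)) / lam i ^ 2 -
      (-p ^ 2 * Real.log (lam i) + p * γ + α)) l (𝓝 0) := by
  have hvw : Tendsto v l (𝓝[>] 0) := tendsto_nhdsWithin_iff.2 ⟨hv0, hv⟩
  -- `e` is the remainder divided by `v`, which tends to `α`; `s = o(1)` is such that
  -- `1 / lam = (1 + s) / v`
  set e : ι → ℝ := fun i => (1 / v i - p * Real.log (v i) + γ - 1 / lam i) / v i with he
  set s : ι → ℝ := fun i => v i * (-p * Real.log (v i) + γ - v i * e i) with hs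
  have hinv : ∀ᶠ i in l, 1 / lam i = (1 + s i) / v i := by
    filter_upwards [hv] with i hi
    have : v i * e i = 1 / v i - p * Real.log (v i) + γ - 1 / lam i := by
      simp only [he]; field_simp
    simp only [hs]
    rw [this]; field_simp; ring
  have hvlog : Tendsto (fun i => v i * Real.log (v i)) l (𝓝 0) := by
    simpa [Function.comp_def] using (tendsto_mul_log_pow_nhdsGT_zero 1).comp hvw
  have hve : Tendsto (fun i => v i * e i) l (𝓝 0) := by simpa using hv0.mul hE
  have hs0 : Tendsto s l (𝓝 0) := by
    have := ((hvlog.const_mul (-p)).add (hv0.const_mul γ)).sub (hv0.mul hve)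
    simp only [mul_zero, add_zero, sub_zero] at this
    exact this.congr fun i => by simp only [hs]; ring
  have hs1 : ∀ᶠ i in l, 0 < 1 + s i := by
    filter_upwards [hs0.eventually (lt_mem_nhds (show (-1 : ℝ) < 0 by norm_num))] with i hi
    linarith
  have hlam : ∀ᶠ i in l, lam i = v i / (1 + s i) := by
    filter_upwards [hinv] with i hi
    rw [← inv_div, ← hi, one_div, inv_inv]
  have hlpos : ∀ᶠ i in l, 0 < lam i := by
    filter_upwards [hlam, hv, hs1] with i h1 h2 h3
    rw [h1]; positivity
  have hratio : Tendsto (fun i => lam i / v i) l (𝓝 1) := by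
    have h : Tendsto (fun i => (1 + s i)⁻¹) l (𝓝 (1 + 0)⁻¹) :=
      (hs0.const_add 1).inv₀ (by norm_num)
    simp only [add_zero, inv_one] at h
    refine h.congr' ?_
    filter_upwards [hlam, hv, hs1] with i h1 h2 h3
    rw [h1]; field_simp
  have hratio' : Tendsto (fun i => v i / lam i) l (𝓝 1) := by
    simpa using hratio.inv₀ one_ne_zero
  have hl0 : Tendsto lam l (𝓝 0) := by
    have := hratio.mul hv0
    rw [mul_zero] at this
    refine this.congr' ?_
    filter_upwards [hv] with i hi using div_mul_cancel₀ _ hi.ne'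
  have hlw : Tendsto lam l (𝓝[>] 0) := tendsto_nhdsWithin_iff.2 ⟨hl0, hlpos⟩
  refine ⟨hlpos, hl0, hratio, ?_⟩
  set u : ι → ℝ := fun i => lam i / v i - 1 with hu
  have hu0 : Tendsto u l (𝓝 0) := by simpa using hratio.sub_const 1
  set ε : ι → ℝ := fun i => Real.log (1 + u i) with hε
  have hε0 : Tendsto ε l (𝓝 0) := by
    have h := (Real.continuousAt_log (x := 1 + 0) (by norm_num)).tendsto.comp (hu0.const_add 1)
    simpa [Function.comp_def] using h
  have hlogv : ∀ᶠ i in l, Real.log (v i) = Real.log (lam i) - ε i := by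
    filter_upwards [hv, hlpos] with i h1 h2
    simp only [hε, hu]
    rw [add_sub_cancel, Real.log_div h2.ne' h1.ne']; ring
  have hul : ∀ᶠ i in l, u i = lam i * (p * (Real.log (lam i) - ε i) - γ + v i * e i) := by
    filter_upwards [hv, hlpos, hinv, hlogv] with i h1 h2 h3 h4
    have h5 : 1 + s i = v i / lam i := by
      rw [div_eq_div_iff h2.ne' h1.ne'] at h3
      field_simp; linarith
    have h6 : v i * (-p * (Real.log (lam i) - ε i) + γ - v i * e i) = v i / lam i - 1 := by
      rw [← h5, ← h4]; simp only [hs]; ring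
    have h7 : -p * (Real.log (lam i) - ε i) + γ - v i * e i = 1 / lam i - 1 / v i := by
      have : v i * (1 / lam i - 1 / v i) = v i / lam i - 1 := by field_simp
      exact mul_left_cancel₀ h1.ne' (h6.trans this.symm)
    have h8 : p * (Real.log (lam i) - ε i) - γ + v i * e i = 1 / v i - 1 / lam i := by linarith
    rw [h8]; simp only [hu]; field_simp
  -- `δ` is the error in `u / lam ≈ p * log lam - γ`
  set δ : ι → ℝ := fun i => -p * ε i + v i * e i with hδ
  have hδ0 : Tendsto δ l (𝓝 0) := by
    have := (hε0.const_mul (-p)).add hve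
    rwa [mul_zero, add_zero] at this
  have hu2 : Tendsto (fun i => u i ^ 2 / lam i) l (𝓝 0) := by
    have h1 : Tendsto (fun i => lam i * Real.log (lam i) ^ 2) l (𝓝 0) :=
      (tendsto_mul_log_pow_nhdsGT_zero 2).comp hlw
    have h2 : Tendsto (fun i => lam i * Real.log (lam i)) l (𝓝 0) := by
      simpa [Function.comp_def] using (tendsto_mul_log_pow_nhdsGT_zero 1).comp hlw
    have h3 : Tendsto (fun i => δ i - γ) l (𝓝 (0 - γ)) := hδ0.sub_const γ
    have := ((h1.const_mul (p ^ 2)).add ((h2.mul h3).const_mul (2 * p))).add (hl0.mul (h3.pow 2))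
    simp only [mul_zero, zero_mul, add_zero] at this
    refine this.congr' ?_
    filter_upwards [hul, hlpos] with i h1 h2
    rw [h1]; simp only [hδ]; field_simp; ring
  -- squeeze by `u - u ^ 2 / (1 + u) ≤ log (1 + u) ≤ u`
  have hεu : Tendsto (fun i => (u i - ε i) / lam i) l (𝓝 0) := by
    have hupos : ∀ᶠ i in l, 0 < 1 + u i := by
      filter_upwards [hu0.eventually (lt_mem_nhds (show (-1 : ℝ) < 0 by norm_num))] with i hi
      linarith
    have hup : Tendsto (fun i => u i ^ 2 / lam i / (1 + u i)) l (𝓝 (0 / (1 + 0))) :=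
      hu2.div (hu0.const_add 1) (by norm_num)
    rw [zero_div] at hup
    refine squeeze_zero' ?_ ?_ hup
    · filter_upwards [hlpos, hupos] with i h1 h2
      refine div_nonneg ?_ h1.le
      have := Real.log_le_sub_one_of_pos h2
      simp only [hε]; linarith
    · filter_upwards [hlpos, hupos] with i h1 h2
      rw [div_right_comm]
      refine div_le_div_of_nonneg_right ?_ h1.le
      have := Real.one_sub_inv_le_log_of_pos h2
      have h3 : u i ^ 2 / (1 + u i) = u i - (1 - (1 + u i)⁻¹) := by field_simp; ring
      rw [h3]; simp only [hε]; linarith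
  have hfin := (((hεu.sub hδ0).const_mul p).add ((hratio'.mul hE).sub_const α))
  simp only [mul_zero, one_mul, sub_self, add_zero] at hfin
  refine hfin.congr' ?_
  filter_upwards [hul, hlpos] with i h1 h2
  change _ = (u i - lam i * (p * Real.log (lam i) - γ)) / lam i ^ 2 - _
  have h3 : (u i - ε i) / lam i = p * (Real.log (lam i) - ε i) - γ + v i * e i - ε i / lam i := by
    rw [sub_div]; nth_rewrite 1 [h1]; field_simp
  change p * ((u i - ε i) / lam i - δ i) + (v i / lam i * e i - α) = _
  rw [h3, h1]; simp only [hδ]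
  field_simp
  ring

/-- The reciprocal of the expansion in `log_inversion`, that is `v` in terms of `lam` up to
`o(lam ^ 3)`. -/
theorem log_inversion_inv {ι : Type*} {l : Filter ι} {v lam : ι → ℝ} {p γ α : ℝ}
    (hv : ∀ᶠ i in l, 0 < v i) (hv0 : Tendsto v l (𝓝 0))
    (hE : Tendsto (fun i => (1 / v i - p * Real.log (v i) + γ - 1 / lam i) / v i) l (𝓝 α)) :
    Tendsto (fun i => (v i / lam i - (1 - lam i * (p * Real.log (lam i) - γ) +
      lam i ^ 2 * ((p * Real.log (lam i) - γ) ^ 2 + p ^ 2 * Real.log (lam i) - p * γ - α))) /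
      lam i ^ 2) l (𝓝 0) := by
  obtain ⟨hlpos, hl0, hratio, hmain⟩ := log_inversion hv hv0 hE
  have hlw : Tendsto lam l (𝓝[>] 0) := tendsto_nhdsWithin_iff.2 ⟨hl0, hlpos⟩
  have hratio' : Tendsto (fun i => v i / lam i) l (𝓝 1) := by
    simpa using hratio.inv₀ one_ne_zero
  -- `lam / v = 1 + lam * a + lam ^ 2 * b` exactly, where `ρ = o(1)` is the error term inside `b`
  set a : ι → ℝ := fun i => p * Real.log (lam i) - γ with ha
  set ρ : ι → ℝ := fun i => (lam i / v i - 1 - lam i * (p * Real.log (lam i) - γ)) / lam i ^ 2 -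
      (-p ^ 2 * Real.log (lam i) + p * γ + α) with hρ
  set b : ι → ℝ := fun i => -p ^ 2 * Real.log (lam i) + p * γ + α + ρ i with hb
  have hL (k : ℕ) : Tendsto (fun i => lam i * Real.log (lam i) ^ k) l (𝓝 0) :=
    (tendsto_mul_log_pow_nhdsGT_zero k).comp hlw
  have hL1 : Tendsto (fun i => lam i * Real.log (lam i)) l (𝓝 0) := by simpa using hL 1
  have hla : Tendsto (fun i => lam i * a i) l (𝓝 0) := by
    have := (hL1.const_mul p).sub (hl0.mul_const γ)
    simp only [mul_zero, zero_mul, sub_zero] at this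
    exact this.congr fun i => by simp only [ha]; ring
  have hlb : Tendsto (fun i => lam i * b i) l (𝓝 0) := by
    have := (hL1.const_mul (-p ^ 2)).add (hl0.mul (hmain.const_add (p * γ + α)))
    simp only [mul_zero, zero_mul, add_zero] at this
    exact this.congr fun i => by simp only [hb, hρ]; ring
  have hlab : Tendsto (fun i => lam i * (a i * b i)) l (𝓝 0) := by
    have h1 := (hL 2).const_mul (-p ^ 3)
    have h3 := hL1.mul (hmain.const_mul p)
    have h4 := (hl0.mul (hmain.const_add (p * γ + α))).const_mul (-γ)
    have h5 := hL1.mul_const (p * (p * γ + α) + γ * p ^ 2)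
    have := ((h1.add h5).add h3).add h4
    simp only [mul_zero, zero_mul, add_zero] at this
    exact this.congr fun i => by simp only [ha, hb, hρ]; ring
  have hla3 : Tendsto (fun i => lam i * a i ^ 3) l (𝓝 0) := by
    have := ((((hL 3).const_mul (p ^ 3)).sub ((hL 2).const_mul (3 * p ^ 2 * γ))).add
      (hL1.const_mul (3 * p * γ ^ 2))).sub (hl0.const_mul (γ ^ 3))
    simp only [mul_zero, add_zero, sub_zero] at this
    exact this.congr fun i => by simp only [ha]; ring
  -- in `v / lam = 1 / (1 + u) = 1 - u + u ^ 2 - u ^ 3 / (1 + u)`, divided by `lam ^ 2`: the error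
  -- of `u ^ 2 ≈ (lam * a) ^ 2`, and the cubic remainder
  have hA : Tendsto (fun i => 2 * (lam i * (a i * b i)) + (lam i * b i) ^ 2) l (𝓝 0) := by
    simpa using (hlab.const_mul 2).add (hlb.pow 2)
  have hB : Tendsto (fun i => v i / lam i * (lam i * a i ^ 3 +
      3 * (lam i * a i) * (lam i * (a i * b i)) + 3 * (lam i * a i) * (lam i * b i) ^ 2 +
      lam i * (lam i * b i) ^ 3)) l (𝓝 0) := by
    have := hratio'.mul (((hla3.add ((hla.const_mul 3).mul hlab)).add
      ((hla.const_mul 3).mul (hlb.pow 2))).add (hl0.mul (hlb.pow 3)))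
    simpa using this
  have := (hA.sub hB).sub hmain
  simp only [sub_zero] at this
  refine this.congr' ?_
  filter_upwards [hlpos, hv] with i h1 h2
  change _ - ρ i = (v i / lam i - (1 - lam i * a i + lam i ^ 2 *
    (a i ^ 2 + p ^ 2 * Real.log (lam i) - p * γ - α))) / lam i ^ 2
  have hρb : ρ i = b i - (-p ^ 2 * Real.log (lam i) + p * γ + α) := by simp only [hb]; ring
  have hvl : lam i / v i = 1 + lam i * a i + lam i ^ 2 * b i := by
    have : b i = (lam i / v i - 1 - lam i * a i) / lam i ^ 2 := by simp only [hb, hρ, ha]; ring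
    rw [this]; field_simp; ring
  have hx : v i / lam i * (1 + lam i * a i + lam i ^ 2 * b i) = 1 := by
    rw [← hvl]; field_simp
  rw [hρb, eq_div_iff (by positivity)]
  generalize v i / lam i = t at hx ⊢
  generalize a i = A at hx ⊢
  generalize b i = B at hx ⊢
  generalize lam i = y at hx ⊢
  linear_combination (-(y * A + y ^ 2 * B) ^ 2 + (y * A + y ^ 2 * B) - 1) * hx

/-! ### The normal distribution function -/

open ProbabilityTheory in
theorem normalN_eq_cdf_gaussianReal (y : ℝ) : normalN y = cdf (gaussianReal 0 1) y := by
  rw [cdf_eq_real, measureReal_def, gaussianReal_apply_eq_integral 0 one_ne_zero,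
    ENNReal.toReal_ofReal (integral_nonneg fun u => gaussianPDFReal_nonneg 0 1 u),
    normalN, ← integral_const_mul]
  simp [gaussianPDFReal_def]

theorem tendsto_normalN_atTop : Tendsto normalN atTop (𝓝 1) :=
  (ProbabilityTheory.tendsto_cdf_atTop _).congr fun y => (normalN_eq_cdf_gaussianReal y).symm

theorem tendsto_normalN_atBot : Tendsto normalN atBot (𝓝 0) :=
  (ProbabilityTheory.tendsto_cdf_atBot _).congr fun y => (normalN_eq_cdf_gaussianReal y).symm

theorem hasDerivAt_normalN (y : ℝ) :
    HasDerivAt normalN (1 / Real.sqrt (2 * Real.pi) * Real.exp (-y ^ 2 / 2)) y := by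
  have hcont : Continuous fun u : ℝ => Real.exp (-u ^ 2 / 2) := by fun_prop
  have hint : Integrable fun u : ℝ => Real.exp (-u ^ 2 / 2) := by
    refine (integrable_exp_neg_mul_sq (b := 1 / 2) (by norm_num)).congr (.of_forall fun u => ?_)
    simp only
    congr 1; ring
  have h (z : ℝ) : normalN z = normalN 0 +
      1 / Real.sqrt (2 * Real.pi) * ∫ u in (0 : ℝ)..z, Real.exp (-u ^ 2 / 2) := by
    rw [← intervalIntegral.integral_Iic_sub_Iic hint.integrableOn hint.integrableOn]
    simp only [normalN]; ring
  rw [funext h]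
  exact ((intervalIntegral.integral_hasDerivAt_right (hcont.intervalIntegrable 0 y)
    (hcont.stronglyMeasurableAtFilter _ _) hcont.continuousAt).const_mul _).const_add _

/-! ### The Black–Scholes price as a function of the total volatility -/

section BlackScholes

variable {S K : ℝ}

theorem log_div_eq_neg_logMoneyness (S K : ℝ) : Real.log (S / K) = -logMoneyness S K := by
  rw [logMoneyness, ← Real.log_inv, inv_div]

/-- The price depends on `σ` and `T` only through the total volatility `σ √T`, which is thus the
volatility for unit maturity. -/
theorem bsCall_eq_bsCall_one (S K σ : ℝ) {T : ℝ} (hT : 0 ≤ T) :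
    bsCall S K T σ = bsCall S K 1 (σ * Real.sqrt T) := by
  simp [bsCall, dPlus, dMinus, mul_pow, Real.sq_sqrt hT]

theorem dPlus_one_eq {w : ℝ} (hw : 0 < w) :
    dPlus S K 1 w = w / 2 - logMoneyness S K * w⁻¹ := by
  rw [dPlus, log_div_eq_neg_logMoneyness, Real.sqrt_one]; field_simp; ring

theorem dMinus_one_eq {w : ℝ} (hw : 0 < w) :
    dMinus S K 1 w = -(w / 2) - logMoneyness S K * w⁻¹ := by
  rw [dMinus, log_div_eq_neg_logMoneyness, Real.sqrt_one]; field_simp; ring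

/-- The vega at unit maturity. The contributions of `d₊'` and `d₋'` combine because
`S * N' d₊ = K * N' d₋`. -/
theorem hasDerivAt_bsCall_one (hS : 0 < S) (hK : 0 < K) {w : ℝ} (hw : 0 < w) :
    HasDerivAt (bsCall S K 1)
      (S * (Real.exp (logMoneyness S K / 2) / Real.sqrt (2 * Real.pi) *
        Real.exp (-logMoneyness S K ^ 2 / (2 * w ^ 2) - w ^ 2 / 8))) w := by
  set x := logMoneyness S K with hx
  have hKS : K = S * Real.exp x := by
    rw [hx, logMoneyness, Real.exp_log (by positivity)]; field_simp
  have hp : HasDerivAt (dPlus S K 1) (1 / 2 + x * (w ^ 2)⁻¹) w := by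
    have h : HasDerivAt (fun w : ℝ => w / 2 - x * w⁻¹) (1 / 2 + x * (w ^ 2)⁻¹) w := by
      simpa using ((hasDerivAt_id w).div_const 2).fun_sub ((hasDerivAt_inv hw.ne').const_mul x)
    refine h.congr_of_eventuallyEq ?_
    filter_upwards [lt_mem_nhds hw] with t ht using dPlus_one_eq ht
  have hm : HasDerivAt (dMinus S K 1) (-(1 / 2) + x * (w ^ 2)⁻¹) w := by
    have h : HasDerivAt (fun w : ℝ => -(w / 2) - x * w⁻¹) (-(1 / 2) + x * (w ^ 2)⁻¹) w := by
      simpa using ((hasDerivAt_id w).div_const 2).fun_neg.fun_sub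
        ((hasDerivAt_inv hw.ne').const_mul x)
    refine h.congr_of_eventuallyEq ?_
    filter_upwards [lt_mem_nhds hw] with t ht using dMinus_one_eq ht
  have h := (((hasDerivAt_normalN _).comp w hp).const_mul S).fun_sub
    (((hasDerivAt_normalN _).comp w hm).const_mul K)
  refine h.congr_deriv ?_
  have e1 : Real.exp (-dPlus S K 1 w ^ 2 / 2) =
      Real.exp (x / 2) * Real.exp (-x ^ 2 / (2 * w ^ 2) - w ^ 2 / 8) := by
    rw [dPlus_one_eq hw, ← Real.exp_add, ← hx]; congr 1; field_simp; ring
  have e2 : Real.exp x * Real.exp (-dMinus S K 1 w ^ 2 / 2) =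
      Real.exp (x / 2) * Real.exp (-x ^ 2 / (2 * w ^ 2) - w ^ 2 / 8) := by
    rw [dMinus_one_eq hw, ← Real.exp_add, ← Real.exp_add, ← hx]; congr 1; field_simp; ring
  rw [e1]
  nth_rewrite 1 [hKS]
  linear_combination (-S * (1 / Real.sqrt (2 * Real.pi)) * (-(1 / 2) + x * (w ^ 2)⁻¹)) * e2

theorem continuousOn_bsCall_one (hS : 0 < S) (hK : 0 < K) :
    ContinuousOn (bsCall S K 1) (Set.Ioi 0) := fun _ hw =>
  (hasDerivAt_bsCall_one hS hK hw).continuousAt.continuousWithinAt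

theorem strictMonoOn_bsCall_one (hS : 0 < S) (hK : 0 < K) :
    StrictMonoOn (bsCall S K 1) (Set.Ioi 0) := by
  refine strictMonoOn_of_deriv_pos (convex_Ioi 0) (continuousOn_bsCall_one hS hK) fun w hw => ?_
  rw [interior_Ioi] at hw
  rw [(hasDerivAt_bsCall_one hS hK hw).deriv]
  positivity

theorem tendsto_bsCall_one_atTop (S K : ℝ) : Tendsto (bsCall S K 1) atTop (𝓝 S) := by
  have hinv : Tendsto (fun w : ℝ => logMoneyness S K * w⁻¹) atTop (𝓝 0) := by
    simpa using tendsto_inv_atTop_zero.const_mul (logMoneyness S K)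
  have hhalf : Tendsto (fun w : ℝ => w / 2) atTop atTop := tendsto_id.atTop_div_const (by norm_num)
  have hp : Tendsto (dPlus S K 1) atTop atTop := by
    refine (hhalf.atTop_add hinv.neg).congr' ?_
    filter_upwards [eventually_gt_atTop 0] with w hw
    rw [dPlus_one_eq hw]; ring
  have hm : Tendsto (dMinus S K 1) atTop atBot := by
    refine ((tendsto_neg_atTop_atBot.comp hhalf).atBot_add hinv.neg).congr' ?_
    filter_upwards [eventually_gt_atTop 0] with w hw
    rw [dMinus_one_eq hw, Function.comp]; ring
  change Tendsto (fun w => S * normalN (dPlus S K 1 w) - K * normalN (dMinus S K 1 w)) _ _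
  simpa [Function.comp_def] using ((tendsto_normalN_atTop.comp hp).const_mul S).sub
    ((tendsto_normalN_atBot.comp hm).const_mul K)

theorem tendsto_bsCall_one_nhdsGT_zero (hS : 0 < S) (hK : 0 < K) (hne : K ≠ S) :
    Tendsto (bsCall S K 1) (𝓝[>] 0) (𝓝 (intrinsicValue S K)) := by
  have hhalf : Tendsto (fun w : ℝ => w / 2) (𝓝[>] 0) (𝓝 0) := by
    have : Tendsto (fun w : ℝ => w / 2) (𝓝 0) (𝓝 (0 / 2)) := tendsto_id.div_const 2
    rw [zero_div] at this
    exact this.mono_left nhdsWithin_le_nhds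
  have hpeq : ∀ᶠ w in 𝓝[>] (0 : ℝ), -logMoneyness S K * w⁻¹ + w / 2 = dPlus S K 1 w := by
    filter_upwards [self_mem_nhdsWithin] with w hw
    rw [dPlus_one_eq hw]; ring
  have hmeq : ∀ᶠ w in 𝓝[>] (0 : ℝ), -logMoneyness S K * w⁻¹ + -(w / 2) = dMinus S K 1 w := by
    filter_upwards [self_mem_nhdsWithin] with w hw
    rw [dMinus_one_eq hw]; ring
  rcases lt_or_gt_of_ne hne with h | h
  · have hx : logMoneyness S K < 0 := Real.log_neg (by positivity) ((div_lt_one hS).2 h)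
    have hinv : Tendsto (fun w : ℝ => -logMoneyness S K * w⁻¹) (𝓝[>] 0) atTop :=
      tendsto_inv_nhdsGT_zero.const_mul_atTop (by linarith)
    have hp := (hinv.atTop_add hhalf).congr' hpeq
    have hm := (hinv.atTop_add hhalf.neg).congr' hmeq
    rw [intrinsicValue, max_eq_left (by linarith)]
    change Tendsto (fun w => S * normalN (dPlus S K 1 w) - K * normalN (dMinus S K 1 w)) _ _
    simpa [Function.comp_def] using ((tendsto_normalN_atTop.comp hp).const_mul S).sub
      ((tendsto_normalN_atTop.comp hm).const_mul K)
  · have hx : 0 < logMoneyness S K := Real.log_pos ((one_lt_div hS).2 h)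
    have hinv : Tendsto (fun w : ℝ => -logMoneyness S K * w⁻¹) (𝓝[>] 0) atBot :=
      tendsto_inv_nhdsGT_zero.const_mul_atTop_of_neg (by linarith)
    have hp := (hinv.atBot_add hhalf).congr' hpeq
    have hm := (hinv.atBot_add hhalf.neg).congr' hmeq
    rw [intrinsicValue, max_eq_right (by linarith)]
    change Tendsto (fun w => S * normalN (dPlus S K 1 w) - K * normalN (dMinus S K 1 w)) _ _
    simpa [Function.comp_def] using ((tendsto_normalN_atBot.comp hp).const_mul S).sub
      ((tendsto_normalN_atBot.comp hm).const_mul K)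

theorem bsCall_one_lt_spot (hS : 0 < S) (hK : 0 < K) {w : ℝ} (hw : 0 < w) :
    bsCall S K 1 w < S := by
  have h1 : (0 : ℝ) < w + 1 := by linarith
  refine (strictMonoOn_bsCall_one hS hK hw h1 (by linarith)).trans_le
    (ge_of_tendsto (tendsto_bsCall_one_atTop S K) ?_)
  filter_upwards [eventually_ge_atTop (w + 1)] with t ht
  exact (strictMonoOn_bsCall_one hS hK).monotoneOn h1 (h1.trans_le ht) ht

theorem intrinsicValue_lt_bsCall_one (hS : 0 < S) (hK : 0 < K) (hne : K ≠ S) {w : ℝ}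
    (hw : 0 < w) : intrinsicValue S K < bsCall S K 1 w := by
  have h1 : 0 < w / 2 := by linarith
  refine lt_of_le_of_lt (le_of_tendsto (tendsto_bsCall_one_nhdsGT_zero hS hK hne) ?_)
    (strictMonoOn_bsCall_one hS hK h1 hw (by linarith))
  filter_upwards [Ioc_mem_nhdsGT h1] with t ht
  exact (strictMonoOn_bsCall_one hS hK).monotoneOn ht.1 h1 ht.2

/-- If a price lies between two Black–Scholes prices, the implied volatility is a genuine solution
and not a default value of `Function.invFunOn`. -/
theorem impliedVol_spec {T c : ℝ} (hS : 0 < S) (hK : 0 < K) (hT : 0 < T) {a b : ℝ} (ha : 0 < a)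
    (hb : 0 < b) (hac : bsCall S K 1 a ≤ c) (hcb : c ≤ bsCall S K 1 b) :
    0 < impliedVol S K T c ∧ bsCall S K 1 (impliedVol S K T c * Real.sqrt T) = c := by
  obtain ⟨w, hw, hwc⟩ := isPreconnected_Ioi.intermediate_value (Set.mem_Ioi.2 ha)
    (Set.mem_Ioi.2 hb) (continuousOn_bsCall_one hS hK) ⟨hac, hcb⟩
  have hsq : 0 < Real.sqrt T := Real.sqrt_pos.2 hT
  have hex : ∃ σ ∈ Set.Ioi (0 : ℝ), (fun σ => bsCall S K T σ) σ = c := by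
    refine ⟨w / Real.sqrt T, div_pos hw hsq, ?_⟩
    simp only
    rw [bsCall_eq_bsCall_one S K _ hT.le, div_mul_cancel₀ _ hsq.ne', hwc]
  refine ⟨Function.invFunOn_mem hex, ?_⟩
  rw [← bsCall_eq_bsCall_one S K _ hT.le]
  exact Function.invFunOn_eq hex

/-- As the price tends to the intrinsic value from above, the implied volatility reproduces the
price and the total volatility tends to `0`. -/
theorem impliedVol_shortExpiry {C : ℝ → ℝ} (hS : 0 < S) (hK : 0 < K) (hne : K ≠ S)
    (hC : ∀ᶠ T in 𝓝[>] (0 : ℝ), intrinsicValue S K < C T)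
    (hlim : Tendsto C (𝓝[>] (0 : ℝ)) (𝓝 (intrinsicValue S K))) :
    (∀ᶠ T in 𝓝[>] (0 : ℝ), 0 < impliedVol S K T (C T) ∧
      bsCall S K 1 (impliedVol S K T (C T) * Real.sqrt T) = C T) ∧
    Tendsto (fun T => impliedVol S K T (C T) * Real.sqrt T) (𝓝[>] 0) (𝓝 0) := by
  have hspec : ∀ᶠ T in 𝓝[>] (0 : ℝ), 0 < impliedVol S K T (C T) ∧
      bsCall S K 1 (impliedVol S K T (C T) * Real.sqrt T) = C T := by
    filter_upwards [hC, self_mem_nhdsWithin,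
      hlim.eventually_lt_const (intrinsicValue_lt_bsCall_one hS hK hne one_pos)] with T h1 hT h2
    obtain ⟨a, ha, ha0⟩ := (((tendsto_bsCall_one_nhdsGT_zero hS hK hne).eventually_lt_const h1).and
      self_mem_nhdsWithin).exists
    exact impliedVol_spec hS hK hT ha0 one_pos ha.le h2.le
  refine ⟨hspec, tendsto_order.2 ⟨fun a ha => ?_, fun b hb => ?_⟩⟩
  · filter_upwards [hspec] with T h
    exact ha.trans_le (mul_nonneg h.1.le (Real.sqrt_nonneg T))
  · filter_upwards [hspec, self_mem_nhdsWithin,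
      hlim.eventually_lt_const (intrinsicValue_lt_bsCall_one hS hK hne hb)] with T h hT h2
    rw [← h.2] at h2
    exact ((strictMonoOn_bsCall_one hS hK).lt_iff_lt
      (mul_pos h.1 (Real.sqrt_pos.2 hT)) hb).1 h2

/-- As the price tends to the spot from below, the implied volatility reproduces the price and the
total volatility tends to `∞`. -/
theorem impliedVol_largeExpiry {C : ℝ → ℝ} (hS : 0 < S) (hK : 0 < K)
    (hC : ∀ᶠ T in atTop, C T < S) (hlim : Tendsto C atTop (𝓝 S)) :
    (∀ᶠ T in atTop, 0 < impliedVol S K T (C T) ∧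
      bsCall S K 1 (impliedVol S K T (C T) * Real.sqrt T) = C T) ∧
    Tendsto (fun T => impliedVol S K T (C T) * Real.sqrt T) atTop atTop := by
  have hspec : ∀ᶠ T in atTop, 0 < impliedVol S K T (C T) ∧
      bsCall S K 1 (impliedVol S K T (C T) * Real.sqrt T) = C T := by
    filter_upwards [hC, eventually_gt_atTop 0,
      hlim.eventually_const_lt (bsCall_one_lt_spot hS hK one_pos)] with T h1 hT h2
    obtain ⟨b, hb, hb0⟩ := (((tendsto_bsCall_one_atTop S K).eventually_const_lt h1).and
      (eventually_gt_atTop 0)).exists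
    exact impliedVol_spec hS hK hT one_pos hb0 h2.le hb.le
  refine ⟨hspec, tendsto_atTop.2 fun M => ?_⟩
  have hM : 0 < max M 1 := lt_max_of_lt_right one_pos
  filter_upwards [hspec, eventually_gt_atTop 0,
    hlim.eventually_const_lt (bsCall_one_lt_spot hS hK hM)] with T h hT h2
  rw [← h.2] at h2
  exact (le_max_left M 1).trans (((strictMonoOn_bsCall_one hS hK).lt_iff_lt hM
    (mul_pos h.1 (Real.sqrt_pos.2 hT))).1 h2).le

/-! ### The normalized time-value and covered call -/

/-- In the variable `v = 2 w² / x²`, the normalized time-value `e^γ TV / S` has the derivative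
required by `tendsto_laplace_remainder`, with `p = 3 / 2` and `c = x² / 16`. -/
theorem hasDerivAt_timeValue_rescaled (hS : 0 < S) (hK : 0 < K) (hne : K ≠ S) {v : ℝ}
    (hv : 0 < v) :
    HasDerivAt (fun v => 4 * Real.sqrt Real.pi * Real.exp (-logMoneyness S K / 2) /
        |logMoneyness S K| *
        (timeValue S K (bsCall S K 1 (|logMoneyness S K| * Real.sqrt (v / 2))) / S))
      (v ^ ((3 / 2 : ℝ) - 2) * Real.exp (-1 / v - logMoneyness S K ^ 2 / 16 * v)) v := by
  have hx0 : logMoneyness S K ≠ 0 :=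
    Real.log_ne_zero_of_pos_of_ne_one (by positivity) (by rwa [Ne, div_eq_one_iff_eq hS.ne'])
  have hw : 0 < |logMoneyness S K| * Real.sqrt (v / 2) := by positivity
  have h2 : HasDerivAt (fun v : ℝ => |logMoneyness S K| * Real.sqrt (v / 2))
      (|logMoneyness S K| * ((1 / 2) / (2 * Real.sqrt (v / 2)))) v :=
    (((hasDerivAt_id v).div_const 2).sqrt (by simp; positivity)).const_mul _
  have h := ((((hasDerivAt_bsCall_one hS hK hw).comp v h2).sub_const
    (intrinsicValue S K)).div_const S).const_mul (4 * Real.sqrt Real.pi *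
      Real.exp (-logMoneyness S K / 2) / |logMoneyness S K|)
  refine h.congr_deriv ?_
  have habs : |logMoneyness S K| ^ 2 = logMoneyness S K ^ 2 := sq_abs _
  have e0 : -logMoneyness S K ^ 2 / (2 * (|logMoneyness S K| * Real.sqrt (v / 2)) ^ 2) -
      (|logMoneyness S K| * Real.sqrt (v / 2)) ^ 2 / 8 =
      -1 / v - logMoneyness S K ^ 2 / 16 * v := by
    rw [mul_pow, Real.sq_sqrt (by positivity), habs]; field_simp; ring
  have e1 : v ^ ((3 / 2 : ℝ) - 2) = (Real.sqrt v)⁻¹ := by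
    rw [Real.sqrt_eq_rpow, ← Real.rpow_neg hv.le]; norm_num
  have e2 : Real.exp (-logMoneyness S K / 2) = (Real.exp (logMoneyness S K / 2))⁻¹ := by
    rw [← Real.exp_neg]; ring_nf
  have e3 : Real.sqrt 2 ^ 2 = 2 := Real.sq_sqrt (by norm_num)
  rw [e0, e1, e2, Real.sqrt_mul (by norm_num), Real.sqrt_div hv.le]
  have := Real.exp_pos (logMoneyness S K / 2)
  field_simp
  norm_num

/-- In the variable `y = 8 / w²`, the normalized covered call `e^γ CC / S` has the derivative
required by `tendsto_laplace_remainder`, with `p = 1 / 2` and `c = x² / 16`. -/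
theorem hasDerivAt_coveredCall_rescaled (hS : 0 < S) (hK : 0 < K) {y : ℝ} (hy : 0 < y) :
    HasDerivAt (fun y => Real.sqrt Real.pi * Real.exp (-logMoneyness S K / 2) *
        (coveredCall S (bsCall S K 1 (Real.sqrt (8 / y))) / S))
      (y ^ ((1 / 2 : ℝ) - 2) * Real.exp (-1 / y - logMoneyness S K ^ 2 / 16 * y)) y := by
  have hw : 0 < Real.sqrt (8 / y) := by positivity
  have h1 : HasDerivAt (fun y : ℝ => 8 / y) (8 * (-(y ^ 2)⁻¹)) y := by
    simpa [div_eq_mul_inv] using (hasDerivAt_inv hy.ne').const_mul 8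
  have h2 := h1.sqrt (by positivity)
  have h := ((((hasDerivAt_bsCall_one hS hK hw).comp y h2).const_sub S).div_const S).const_mul
    (Real.sqrt Real.pi * Real.exp (-logMoneyness S K / 2))
  refine h.congr_deriv ?_
  have e0 : -logMoneyness S K ^ 2 / (2 * Real.sqrt (8 / y) ^ 2) - Real.sqrt (8 / y) ^ 2 / 8 =
      -1 / y - logMoneyness S K ^ 2 / 16 * y := by
    rw [Real.sq_sqrt (by positivity)]; field_simp; ring
  have e1 : y ^ ((1 / 2 : ℝ) - 2) = Real.sqrt y / y ^ 2 := by
    rw [Real.rpow_sub hy, Real.sqrt_eq_rpow]; norm_num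
  have e2 : Real.exp (-logMoneyness S K / 2) = (Real.exp (logMoneyness S K / 2))⁻¹ := by
    rw [← Real.exp_neg]; ring_nf
  have e3 : Real.sqrt 8 = 2 * Real.sqrt 2 := by
    rw [show (8 : ℝ) = 2 ^ 2 * 2 by norm_num, Real.sqrt_mul (by norm_num),
      Real.sqrt_sq (by norm_num)]
  have e4 : Real.sqrt 2 ^ 2 = 2 := Real.sq_sqrt (by norm_num)
  rw [e0, e1, e2, Real.sqrt_mul (by norm_num), Real.sqrt_div (by norm_num), e3]
  have := Real.exp_pos (logMoneyness S K / 2)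
  field_simp
  norm_num

end BlackScholes

/-! ### Expansions of the implied volatility -/

/-- The short-expiry expansion of `v = 2 σ² T / x²`, as a limit. -/
theorem shortExpiry_expansion {S K : ℝ} (hS : 0 < S) (hK : 0 < K) (hne : K ≠ S) {C : ℝ → ℝ}
    (hC : ∀ᶠ T in 𝓝[>] (0 : ℝ), intrinsicValue S K < C T)
    (hlim : Tendsto C (𝓝[>] (0 : ℝ)) (𝓝 (intrinsicValue S K))) {x γ : ℝ}
    (hx : x = logMoneyness S K)
    (hγ : γ = Real.log (4 * Real.sqrt Real.pi * Real.exp (-x / 2) / |x|)) {lam v : ℝ → ℝ}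
    (hlam : ∀ T, lam T = -1 / Real.log (timeValue S K (C T) / S))
    (hv : ∀ T, v T = impliedVol S K T (C T) ^ 2 * T * 2 / x ^ 2) :
    x ≠ 0 ∧ (∀ᶠ T in 𝓝[>] (0 : ℝ), 0 < lam T) ∧
    Tendsto (fun T => (v T / lam T - (1 - lam T * (3 / 2 * Real.log (lam T) - γ) +
      lam T ^ 2 * ((3 / 2 * Real.log (lam T) - γ) ^ 2 + (3 / 2) ^ 2 * Real.log (lam T) -
        3 / 2 * γ - (-(3 / 2) - x ^ 2 / 16)))) / lam T ^ 2) (𝓝[>] 0) (𝓝 0) := by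
  have hx0 : x ≠ 0 := hx ▸
    Real.log_ne_zero_of_pos_of_ne_one (by positivity) (by rwa [Ne, div_eq_one_iff_eq hS.ne'])
  obtain ⟨hspec, hw0⟩ := impliedVol_shortExpiry hS hK hne hC hlim
  have hT0 : ∀ᶠ T in 𝓝[>] (0 : ℝ), 0 < T := self_mem_nhdsWithin
  have hveq : ∀ᶠ T in 𝓝[>] (0 : ℝ),
      v T = (impliedVol S K T (C T) * Real.sqrt T) ^ 2 * (2 / x ^ 2) := by
    filter_upwards [hT0] with T hT
    rw [hv, mul_pow, Real.sq_sqrt hT.le]; ring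
  have hvpos : ∀ᶠ T in 𝓝[>] (0 : ℝ), 0 < v T := by
    filter_upwards [hT0, hspec] with T hT h
    have := h.1
    rw [hv]; positivity
  have hv0 : Tendsto v (𝓝[>] 0) (𝓝 0) := by
    have := (hw0.pow 2).mul_const (2 / x ^ 2)
    simp only [ne_eq, OfNat.ofNat_ne_zero, not_false_eq_true, zero_pow, zero_mul] at this
    exact this.congr' (hveq.mono fun T h => h.symm)
  have hwv : ∀ᶠ T in 𝓝[>] (0 : ℝ),
      |x| * Real.sqrt (v T / 2) = impliedVol S K T (C T) * Real.sqrt T := by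
    filter_upwards [hspec, hveq] with T h h2
    have h3 : 0 ≤ impliedVol S K T (C T) * Real.sqrt T := mul_nonneg h.1.le (Real.sqrt_nonneg T)
    rw [← Real.sqrt_sq h3, ← Real.sqrt_sq_eq_abs, ← Real.sqrt_mul (sq_nonneg x), h2]
    congr 1; field_simp
  set P : ℝ → ℝ := fun v => 4 * Real.sqrt Real.pi * Real.exp (-x / 2) / |x| *
    (timeValue S K (bsCall S K 1 (|x| * Real.sqrt (v / 2))) / S) with hPdef
  have hP : ∀ v, 0 < v → HasDerivAt P
      (v ^ ((3 / 2 : ℝ) - 2) * Real.exp (-1 / v - x ^ 2 / 16 * v)) v := fun v hv => by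
    simp only [hPdef, hx]
    exact hasDerivAt_timeValue_rescaled hS hK hne hv
  have hP0 : Tendsto P (𝓝[>] 0) (𝓝 0) := by
    have h1 : Tendsto (fun v : ℝ => |x| * Real.sqrt (v / 2)) (𝓝[>] 0) (𝓝[>] 0) := by
      refine tendsto_nhdsWithin_iff.2 ⟨?_, ?_⟩
      · have : Continuous fun v : ℝ => |x| * Real.sqrt (v / 2) := by fun_prop
        have := this.tendsto 0
        simp only [zero_div, Real.sqrt_zero, mul_zero] at this
        exact this.mono_left nhdsWithin_le_nhds
      · filter_upwards [self_mem_nhdsWithin] with v hv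
        have hv : (0 : ℝ) < v := hv
        exact mul_pos (abs_pos.2 hx0) (Real.sqrt_pos.2 (by positivity))
    have h2 := ((((tendsto_bsCall_one_nhdsGT_zero hS hK hne).comp h1).sub_const
      (intrinsicValue S K)).div_const S).const_mul
        (4 * Real.sqrt Real.pi * Real.exp (-x / 2) / |x|)
    simp only [sub_self, zero_div, mul_zero] at h2
    exact h2
  have hvw : Tendsto v (𝓝[>] 0) (𝓝[>] 0) := tendsto_nhdsWithin_iff.2 ⟨hv0, hvpos⟩
  have hE : Tendsto (fun T => (1 / v T - 3 / 2 * Real.log (v T) + γ - 1 / lam T) / v T)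
      (𝓝[>] 0) (𝓝 (-(3 / 2) - x ^ 2 / 16)) := by
    refine ((tendsto_log_laplace_remainder (by norm_num) hP hP0).comp hvw).congr' ?_
    filter_upwards [hC, hspec, hwv] with T h1 h2 h3
    have hTV : 0 < timeValue S K (C T) / S := div_pos (sub_pos.2 h1) hS
    have hc : 0 < 4 * Real.sqrt Real.pi * Real.exp (-x / 2) / |x| := by positivity
    have hlog : Real.log (P (v T)) = γ - 1 / lam T := by
      simp only [hPdef]
      rw [h3, h2.2, Real.log_mul hc.ne' hTV.ne', ← hγ, hlam, one_div_div]
      ring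
    rw [Function.comp, hlog]
    ring
  exact ⟨hx0, (log_inversion hvpos hv0 hE).1, log_inversion_inv hvpos hv0 hE⟩

/-- The large-expiry expansion of `lam / y`, where `y = 8 / (σ² T)`, as a limit. -/
theorem largeExpiry_expansion {S K : ℝ} (hS : 0 < S) (hK : 0 < K) {C : ℝ → ℝ}
    (hC : ∀ᶠ T in atTop, C T < S) (hlim : Tendsto C atTop (𝓝 S)) {x γ : ℝ}
    (hx : x = logMoneyness S K)
    (hγ : γ = Real.log (Real.sqrt Real.pi * Real.exp (-x / 2))) {lam y : ℝ → ℝ}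
    (hlam : ∀ T, lam T = -1 / Real.log (coveredCall S (C T) / S))
    (hy : ∀ T, y T = 8 / (impliedVol S K T (C T) ^ 2 * T)) :
    (∀ᶠ T in atTop, 0 < impliedVol S K T (C T)) ∧ (∀ᶠ T in atTop, 0 < lam T) ∧
    Tendsto (fun T => lam T / y T) atTop (𝓝 1) ∧
    Tendsto (fun T => (lam T / y T - 1 - lam T * (1 / 2 * Real.log (lam T) - γ)) / lam T ^ 2 -
      (-(1 / 2) ^ 2 * Real.log (lam T) + 1 / 2 * γ + (-(1 / 2) - x ^ 2 / 16))) atTop (𝓝 0) := by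
  obtain ⟨hspec, hwtop⟩ := impliedVol_largeExpiry hS hK hC hlim
  have hyeq : ∀ᶠ T in atTop, y T = 8 * ((impliedVol S K T (C T) * Real.sqrt T)⁻¹) ^ 2 := by
    filter_upwards [eventually_gt_atTop 0] with T hT
    rw [hy, inv_pow, mul_pow, Real.sq_sqrt hT.le]; ring
  have hypos : ∀ᶠ T in atTop, 0 < y T := by
    filter_upwards [eventually_gt_atTop 0, hspec] with T hT h
    have := h.1
    rw [hy]; positivity
  have hy0 : Tendsto y atTop (𝓝 0) := by
    have := ((tendsto_inv_atTop_zero.comp hwtop).pow 2).const_mul 8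
    simp only [ne_eq, OfNat.ofNat_ne_zero, not_false_eq_true, zero_pow, mul_zero] at this
    exact this.congr' (hyeq.mono fun T h => h.symm)
  have hwy : ∀ᶠ T in atTop, Real.sqrt (8 / y T) = impliedVol S K T (C T) * Real.sqrt T := by
    filter_upwards [hspec, hyeq] with T h h2
    have h3 : 0 ≤ impliedVol S K T (C T) * Real.sqrt T := mul_nonneg h.1.le (Real.sqrt_nonneg T)
    rw [h2, inv_pow, ← div_eq_mul_inv, div_div_cancel₀ (by norm_num), Real.sqrt_sq h3]
  set P : ℝ → ℝ := fun y => Real.sqrt Real.pi * Real.exp (-x / 2) *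
    (coveredCall S (bsCall S K 1 (Real.sqrt (8 / y))) / S) with hPdef
  have hP : ∀ y, 0 < y → HasDerivAt P
      (y ^ ((1 / 2 : ℝ) - 2) * Real.exp (-1 / y - x ^ 2 / 16 * y)) y := fun y hy => by
    simp only [hPdef, hx]
    exact hasDerivAt_coveredCall_rescaled hS hK hy
  have hP0 : Tendsto P (𝓝[>] 0) (𝓝 0) := by
    have h1 : Tendsto (fun y : ℝ => Real.sqrt (8 / y)) (𝓝[>] 0) atTop :=
      Real.tendsto_sqrt_atTop.comp (tendsto_inv_nhdsGT_zero.const_mul_atTop (by norm_num))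
    have h2 := ((((tendsto_bsCall_one_atTop S K).comp h1).const_sub S).div_const S).const_mul
      (Real.sqrt Real.pi * Real.exp (-x / 2))
    simp only [sub_self, zero_div, mul_zero] at h2
    exact h2
  have hyw : Tendsto y atTop (𝓝[>] 0) := tendsto_nhdsWithin_iff.2 ⟨hy0, hypos⟩
  have hE : Tendsto (fun T => (1 / y T - 1 / 2 * Real.log (y T) + γ - 1 / lam T) / y T)
      atTop (𝓝 (-(1 / 2) - x ^ 2 / 16)) := by
    refine ((tendsto_log_laplace_remainder (by norm_num) hP hP0).comp hyw).congr' ?_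
    filter_upwards [hC, hspec, hwy] with T h1 h2 h3
    have hCC : 0 < coveredCall S (C T) / S := div_pos (sub_pos.2 h1) hS
    have hc : 0 < Real.sqrt Real.pi * Real.exp (-x / 2) := by positivity
    have hlog : Real.log (P (y T)) = γ - 1 / lam T := by
      simp only [hPdef]
      rw [h3, h2.2, Real.log_mul hc.ne' hCC.ne', ← hγ, hlam, one_div_div]
      ring
    rw [Function.comp, hlog]
    ring
  obtain ⟨h1, -, h3, h4⟩ := log_inversion hypos hy0 hE
  exact ⟨hspec.mono fun T h => h.1, h1, h3, h4⟩

theorem mainTheorem1 (S K : ℝ) (hS : 0 < S) (hK : 0 < K) (C : ℝ → ℝ) :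
    -- short expiry
    (K ≠ S →
      (∀ᶠ T in 𝓝[>] (0 : ℝ), intrinsicValue S K < C T) →
      Tendsto C (𝓝[>] (0 : ℝ)) (𝓝 (intrinsicValue S K)) →
      let x : ℝ := logMoneyness S K
      let γ : ℝ := Real.log (4 * Real.sqrt Real.pi * Real.exp (-x / 2) / |x|)
      let α₁ : ℝ := -(3 / 2) - x ^ 2 / 16
      let lam : ℝ → ℝ := fun T => -1 / Real.log (timeValue S K (C T) / S)
      let σ : ℝ → ℝ := fun T => impliedVol S K T (C T)
      ∃ v r : ℝ → ℝ,
        r =o[𝓝[>] (0 : ℝ)] (fun T => lam T ^ 3) ∧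
        ∀ᶠ T in 𝓝[>] (0 : ℝ),
          σ T ^ 2 * T = x ^ 2 / 2 * v T ∧
          v T = lam T - 3 / 2 * lam T ^ 2 * Real.log (lam T) + γ * lam T ^ 2
            + 9 / 4 * lam T ^ 3 * Real.log (lam T) ^ 2
            + (9 / 4 - 3 * γ) * lam T ^ 3 * Real.log (lam T)
            + (γ ^ 2 - 3 / 2 * γ - α₁) * lam T ^ 3 + r T) ∧
    -- large expiry
    ((∀ᶠ T in atTop, C T < S) →
      Tendsto C atTop (𝓝 S) →
      let x : ℝ := logMoneyness S K
      let γ : ℝ := Real.log (Real.sqrt Real.pi * Real.exp (-x / 2))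
      let α₁ : ℝ := -(1 / 2) - x ^ 2 / 16
      let lam : ℝ → ℝ := fun T => -1 / Real.log (coveredCall S (C T) / S)
      let σ : ℝ → ℝ := fun T => impliedVol S K T (C T)
      (∃ r : ℝ → ℝ,
        r =o[atTop] (fun T => lam T ^ 2) ∧
        ∀ᶠ T in atTop,
          σ T ^ 2 * T = 8 / lam T *
            (1 + 1 / 2 * lam T * Real.log (lam T) - γ * lam T
              - 1 / 4 * lam T ^ 2 * Real.log (lam T)
              + (γ / 2 + α₁) * lam T ^ 2 + r T)) ∧
      σ ~[atTop] (fun T => 2 * Real.sqrt (-(2 * Real.log (coveredCall S (C T) / S)) / T))) := by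
  refine ⟨fun hne hC hlim => ?_, fun hC hlim => ?_⟩
  · intro x γ α₁ lam σ
    obtain ⟨hx0, hlpos, hmain⟩ := shortExpiry_expansion hS hK hne hC hlim (x := x) (γ := γ)
      (lam := lam) (v := fun T => σ T ^ 2 * T * 2 / x ^ 2) rfl rfl (fun _ => rfl) (fun _ => rfl)
    refine ⟨fun T => σ T ^ 2 * T * 2 / x ^ 2, fun T => σ T ^ 2 * T * 2 / x ^ 2 -
      (lam T - 3 / 2 * lam T ^ 2 * Real.log (lam T) + γ * lam T ^ 2
            + 9 / 4 * lam T ^ 3 * Real.log (lam T) ^ 2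
            + (9 / 4 - 3 * γ) * lam T ^ 3 * Real.log (lam T)
            + (γ ^ 2 - 3 / 2 * γ - α₁) * lam T ^ 3), ?_, ?_⟩
    · refine (isLittleO_iff_tendsto' ?_).2 (hmain.congr' ?_)
      · filter_upwards [hlpos] with T h h2
        exact absurd h2 (pow_pos h 3).ne'
      · filter_upwards [hlpos] with T h
        simp only [α₁]
        generalize σ T ^ 2 * T * 2 / x ^ 2 = v
        generalize lam T = y at h ⊢
        rw [div_eq_div_iff (by positivity) (by positivity)]
        field_simp
        ring
    · refine .of_forall fun T => ⟨?_, by ring⟩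
      field_simp
  · intro x γ α₁ lam σ
    obtain ⟨hσ, hlpos, hratio, hmain⟩ := largeExpiry_expansion hS hK hC hlim (x := x) (γ := γ)
      (lam := lam) (y := fun T => 8 / (σ T ^ 2 * T)) rfl rfl (fun _ => rfl) (fun _ => rfl)
    refine ⟨⟨fun T => lam T * (σ T ^ 2 * T) / 8 -
      (1 + 1 / 2 * lam T * Real.log (lam T) - γ * lam T
              - 1 / 4 * lam T ^ 2 * Real.log (lam T)
              + (γ / 2 + α₁) * lam T ^ 2), ?_, ?_⟩, ?_⟩
    · refine (isLittleO_iff_tendsto' ?_).2 (hmain.congr' ?_)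
      · filter_upwards [hlpos] with T h h2
        exact absurd h2 (pow_pos h 2).ne'
      · filter_upwards [hlpos] with T h
        simp only [α₁]
        rw [div_div_eq_mul_div]
        generalize σ T ^ 2 * T = v
        generalize lam T = y at h ⊢
        field_simp
        ring
    · filter_upwards [hlpos] with T h
      field_simp
      ring
    · have hsq := (Real.continuous_sqrt.tendsto 1).comp hratio
      rw [Real.sqrt_one] at hsq
      have hq : ∀ᶠ T in atTop,
          0 < -(2 * Real.log (coveredCall S (C T) / S)) / T ∧
          Real.log (coveredCall S (C T) / S) = -1 / lam T := by
        filter_upwards [hlpos, eventually_gt_atTop 0] with T h hT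
        have h1 : Real.log (coveredCall S (C T) / S) = -1 / lam T := by
          simp only [lam]; rw [div_div_cancel₀ (by norm_num)]
        refine ⟨div_pos ?_ hT, h1⟩
        rw [h1, neg_div, mul_neg, neg_neg]; positivity
      refine (isEquivalent_iff_tendsto_one ?_).2 (hsq.congr' ?_)
      · filter_upwards [hq] with T h
        exact mul_ne_zero two_ne_zero (Real.sqrt_pos.2 h.1).ne'
      · filter_upwards [hq, hσ, hlpos, eventually_gt_atTop 0] with T h h1 h2 hT
        have h1 : 0 < σ T := h1
        have hpos : 0 ≤ σ T / (2 * Real.sqrt (-(2 * Real.log (coveredCall S (C T) / S)) / T)) := by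
          positivity
        rw [Pi.div_apply, ← Real.sqrt_sq hpos, div_pow, mul_pow, Real.sq_sqrt h.1.le, h.2,
          Function.comp]
        congr 1
        field_simp
        norm_num
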